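/- For $c\in\mathbb C$ let $f_c(z)=z^2+c$, and for a sequence $\omega=(c_0,c_1,c_2,\dots)$ of complex numbers let $f^n_\omega=f_{c_{n-1}}\circ\dots\circ f_{c_1}\circ f_{c_0}$ ($n\in\mathbb N$). The non-autonomous Julia set $J_\omega$ is the set of all $z\in\mathbb C$ such that for every open set $U\ni z$ the family $\{f^n_\omega|_U : n\in\mathbb N\}$ is not normal; here a family of maps from $U$ to the Riemann sphere $\mathbb C\cup\{\infty\}$ is normal if every sequence in it has a subsequence that converges uniformly on compact subsets of $U$ with respect to the chordal metric (the limit may take the value $\infty$). Let $V\subset\mathbb C$ be a bounded open set such that $\mathbb D(0,\tfrac14)\subset V$ and $V\neq\mathbb D(0,\tfrac14)$, where $\mathbb D(0,\tfrac14)=\{z\in\mathbb C:|z|<\tfrac14\}$. Equip the space $\Omega=V^{\mathbb N}$ with the product measure $\mathbb P$ of the uniform distributions (normalized planar Lebesgue measure) on $V$. Then for $\mathbb P$-almost every $\omega\in\Omega$ the Julia set $J_\omega$ is totally disconnected. -/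

import Mathlib

open MeasureTheory

noncomputable section

namespace RandomQuadratic

/-- The non-autonomous iterates `f^n_ω = f_{c_{n-1}} ∘ ⋯ ∘ f_{c_1} ∘ f_{c_0}` of the quadratic
polynomials `f_c(z) = z² + c`, for `ω = (c_0, c_1, …)`; `f^0_ω` is the identity. -/
def iter (ω : ℕ → ℂ) : ℕ → ℂ → ℂ
  | 0, z => z
  | n + 1, z => (iter ω n z) ^ 2 + ω n

/-- The chordal (spherical) distance on the Riemann sphere `ℂ ∪ {∞}`. -/
def chordal : OnePoint ℂ → OnePoint ℂ → ℝ
  | some z, some w => 2 * ‖z - w‖ / (Real.sqrt (1 + ‖z‖ ^ 2) * Real.sqrt (1 + ‖w‖ ^ 2))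
  | some z, none => 2 / Real.sqrt (1 + ‖z‖ ^ 2)
  | none, some w => 2 / Real.sqrt (1 + ‖w‖ ^ 2)
  | none, none => 0

/-- Convergence of sphere-valued functions on `U`, uniform on compact subsets of `U`
with respect to the chordal distance. -/
def ConvergesLocallyUniformlyOn (u : ℕ → ℂ → OnePoint ℂ) (g : ℂ → OnePoint ℂ) (U : Set ℂ) :
    Prop :=
  ∀ K : Set ℂ, IsCompact K → K ⊆ U → ∀ ε : ℝ, 0 < ε →
    ∃ N : ℕ, ∀ n : ℕ, N ≤ n → ∀ z ∈ K, chordal (u n z) (g z) < ε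

/-- A family of sphere-valued functions is normal on `U` if every sequence of members of the family
has a subsequence converging uniformly on compact subsets of `U` in the chordal distance
(the limit may take the value `∞`). -/
def IsNormalOn (F : Set (ℂ → OnePoint ℂ)) (U : Set ℂ) : Prop :=
  ∀ u : ℕ → ℂ → OnePoint ℂ, (∀ k, u k ∈ F) →
    ∃ φ : ℕ → ℕ, StrictMono φ ∧
      ∃ g : ℂ → OnePoint ℂ, ConvergesLocallyUniformlyOn (fun k => u (φ k)) g U

/-- The family of all iterates `f^n_ω`, regarded as maps into the Riemann sphere. -/
def iterates (ω : ℕ → ℂ) : Set (ℂ → OnePoint ℂ) :=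
  Set.range fun (n : ℕ) (z : ℂ) => ((iter ω n z : ℂ) : OnePoint ℂ)

/-- The non-autonomous Julia set: the points no open neighbourhood of which carries normality of
the family of iterates. -/
def juliaSet (ω : ℕ → ℂ) : Set ℂ :=
  {z | ∀ U : Set ℂ, IsOpen U → z ∈ U → ¬ IsNormalOn (iterates ω) U}

/-- The uniform distribution on `V` (normalized planar Lebesgue measure), as a measure on the
subtype `V`. -/
def uniformDist (V : Set ℂ) : Measure V :=
  (ProbabilityTheory.cond volume V).comap Subtype.val

/-- The product of uniform distributions on `V^ℕ`. -/
def productDist (V : Set ℂ) : Measure (ℕ → V) :=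
  Measure.infinitePi fun _ : ℕ => uniformDist V

/-- The uniform distribution on a non-empty bounded open set is a probability measure, so that the
infinite product above is the actual product measure. -/
theorem isProbabilityMeasure_uniformDist {V : Set ℂ} (hV : IsOpen V)
    (hb : Bornology.IsBounded V) (hne : V.Nonempty) : IsProbabilityMeasure (uniformDist V) := by
  have h0 : volume V ≠ 0 := (hV.measure_pos volume hne).ne'
  have ht : volume V ≠ ⊤ := hb.measure_lt_top.ne
  constructor
  rw [uniformDist, (MeasurableEmbedding.subtype_coe hV.measurableSet).comap_apply,
    Set.image_univ, Subtype.range_coe]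
  exact ProbabilityTheory.cond_apply_self h0 ht

end RandomQuadratic

end

noncomputable section

namespace RandomQuadratic

open Metric Set Filter Topology

/-! Points of the Julia set have orbits in the disc of radius `M + 2`, where `M` bounds `V`, so it
suffices that a connected set `T` of points with bounded orbits is a single point.

Probability: since `V` contains the disc of radius 1/4 and a point of modulus greater than 1/4,
every point can be steered to infinity (`canEscape`). Openness and compactness turn this into a
uniform positive chance of escape within a fixed time, so the chance of not having escaped decays
geometrically. A union bound over the birth times of critical points, with a Fatou argument, gives
almost surely an `N` and infinitely many times `n` by which every critical point born no later than
`n - N` has escaped (`ae_frequently_critical_escape`). Almost surely a countable dense set escapes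
too.

Geometry: at such a time `n = m + N`, the map `iter ω m` has inverse branches on discs of a radius
`δ` independent of `n`, centred at the images of points of `T`, and it is injective on `T` enlarged
by these branches (`injOn_iter`). Hence `T` splits into a number of pieces independent of `n`, each
inside the image of one branch. The branches omit an escaping net that becomes arbitrarily fine as
`n` grows, so the pieces become arbitrarily small (`norm_sub_le_of_omits`). A connected set covered
by boundedly many arbitrarily small pieces is a point. -/

/-! ### Iterates, shifts and the escape radius -/

/-- The shifted sequence `(ω_j, ω_{j+1}, …)`. -/
def shift {α : Type*} (j : ℕ) (ω : ℕ → α) : ℕ → α := fun k => ω (k + j)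

theorem shift_shift {α : Type*} (i j : ℕ) (ω : ℕ → α) :
    shift i (shift j ω) = shift (i + j) ω := by
  funext k; simp [shift, add_assoc]

theorem iter_add (ω : ℕ → ℂ) (m n : ℕ) (z : ℂ) :
    iter ω (m + n) z = iter (shift m ω) n (iter ω m z) := by
  induction n with
  | zero => rfl
  | succ n ih => rw [← add_assoc, iter, ih, iter, shift, add_comm n m]

theorem iter_succ_eq (ω : ℕ → ℂ) (n : ℕ) (z : ℂ) :
    iter ω (n + 1) z = iter (shift 1 ω) n (z ^ 2 + ω 0) := by
  rw [add_comm, iter_add]; rfl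

theorem differentiable_iter (ω : ℕ → ℂ) (n : ℕ) : Differentiable ℂ (iter ω n) := by
  induction n with
  | zero => exact differentiable_id
  | succ n ih => exact (ih.pow 2).add_const _

theorem continuous_iter (ω : ℕ → ℂ) (n : ℕ) : Continuous (iter ω n) :=
  (differentiable_iter ω n).continuous

theorem two_mul_norm_le {M : ℝ} {z c : ℂ} (hc : ‖c‖ ≤ M) (hz : M + 2 ≤ ‖z‖) :
    2 * ‖z‖ ≤ ‖z ^ 2 + c‖ := by
  have h1 : ‖z ^ 2‖ ≤ ‖z ^ 2 + c‖ + ‖c‖ := by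
    have := norm_sub_le (z ^ 2 + c) c
    rwa [add_sub_cancel_right] at this
  rw [norm_pow] at h1
  nlinarith [norm_nonneg c]

theorem pow_mul_norm_le_iter {M : ℝ} {ω : ℕ → ℂ} (hω : ∀ i, ‖ω i‖ ≤ M) {z : ℂ}
    (hz : M + 2 ≤ ‖z‖) (n : ℕ) : 2 ^ n * ‖z‖ ≤ ‖iter ω n z‖ := by
  have hM : 0 ≤ M := (norm_nonneg _).trans (hω 0)
  induction n with
  | zero => simp [iter]
  | succ n ih =>
    have h1 : M + 2 ≤ ‖iter ω n z‖ :=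
      hz.trans ((le_mul_of_one_le_left (norm_nonneg _) (one_le_pow₀ one_le_two)).trans ih)
    have := two_mul_norm_le (hω n) h1
    rw [iter, pow_succ]; linarith

theorem norm_le_iter {M : ℝ} {ω : ℕ → ℂ} (hω : ∀ i, ‖ω i‖ ≤ M) {z : ℂ}
    (hz : M + 2 ≤ ‖z‖) (n : ℕ) : ‖z‖ ≤ ‖iter ω n z‖ :=
  (le_mul_of_one_le_left (norm_nonneg _) (one_le_pow₀ one_le_two)).trans
    (pow_mul_norm_le_iter hω hz n)

theorem norm_shift_le {M : ℝ} {ω : ℕ → ℂ} (hω : ∀ i, ‖ω i‖ ≤ M) (j : ℕ) :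
    ∀ i, ‖shift j ω i‖ ≤ M := fun _ => hω _

theorem lt_norm_iter_of_le {M R : ℝ} {ω : ℕ → ℂ} (hω : ∀ i, ‖ω i‖ ≤ M) (hR : M + 2 ≤ R) {z : ℂ}
    {m n : ℕ} (hmn : m ≤ n) (h : R < ‖iter ω m z‖) : R < ‖iter ω n z‖ := by
  obtain ⟨k, rfl⟩ := Nat.exists_eq_add_of_le hmn
  rw [iter_add]
  exact h.trans_le (norm_le_iter (norm_shift_le hω m) (hR.trans h.le) k)

/-! ### Points of the Julia set have bounded orbits -/

theorem chordal_self (x : OnePoint ℂ) : chordal x x = 0 := by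
  cases x <;> simp [chordal]

/-- Once an orbit has left the disc of radius `M + 2`, all nearby orbits tend to infinity at a
uniform geometric rate, which makes the iterates normal there. -/
theorem norm_iter_le_of_mem_juliaSet {M : ℝ} {ω : ℕ → ℂ} (hω : ∀ i, ‖ω i‖ ≤ M) {z : ℂ}
    (hz : z ∈ juliaSet ω) (n : ℕ) : ‖iter ω n z‖ ≤ M + 2 := by
  by_contra! hn
  have hM : 0 ≤ M := (norm_nonneg _).trans (hω 0)
  refine hz {w | M + 2 < ‖iter ω n w‖}
    (isOpen_lt continuous_const (continuous_iter ω n).norm) hn ?_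
  intro u hu
  choose k hk using hu
  -- An index occurring infinitely often gives a constant subsequence; otherwise the indices tend to
  -- infinity and the whole sequence converges to `∞`.
  by_cases hfin : ∃ N, ∃ᶠ i in atTop, k i = N
  · obtain ⟨N, hN⟩ := hfin
    obtain ⟨φ, hφ, hφN⟩ := extraction_of_frequently_atTop hN
    refine ⟨φ, hφ, fun w => ((iter ω N w : ℂ) : OnePoint ℂ), fun K _ _ ε hε => ⟨0, fun i _ w _ => ?_⟩⟩
    simp only [← hk, hφN, chordal_self, hε]
  · push Not at hfin
    have hlim : Tendsto k atTop atTop := by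
      refine tendsto_atTop.2 fun b => ?_
      have : ∀ᶠ i in atTop, ∀ N ∈ Finset.range b, k i ≠ N :=
        (Finset.eventually_all _).2 fun N _ => by simpa using hfin N
      filter_upwards [this] with i hi
      by_contra! hlt
      exact hi (k i) (Finset.mem_range.2 hlt) rfl
    refine ⟨id, strictMono_id, fun _ => OnePoint.infty, fun K _ hKU ε hε => ?_⟩
    obtain ⟨m, hm⟩ := pow_unbounded_of_one_lt (2 / ε) (one_lt_two (α := ℝ))
    obtain ⟨N, hN⟩ := eventually_atTop.1 (tendsto_atTop.1 hlim (n + m))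
    refine ⟨N, fun i hi w hw => ?_⟩
    have hki := hN i hi
    obtain ⟨l, hl⟩ := Nat.exists_eq_add_of_le hki
    have hwU : M + 2 < ‖iter ω n w‖ := hKU hw
    have h1 : 2 ^ (m + l) * ‖iter ω n w‖ ≤ ‖iter ω (k i) w‖ := by
      rw [hl, add_assoc, iter_add]
      exact pow_mul_norm_le_iter (norm_shift_le hω n) hwU.le _
    have h2 : (2 : ℝ) ^ m ≤ 2 ^ (m + l) := pow_le_pow_right₀ one_le_two (by omega)
    have h3 : 2 / ε < ‖iter ω (k i) w‖ := by
      have : (2 : ℝ) ^ (m + l) ≤ 2 ^ (m + l) * ‖iter ω n w‖ :=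
        le_mul_of_one_le_right (by positivity) (by linarith)
      linarith
    have h4 : ‖iter ω (k i) w‖ ≤ Real.sqrt (1 + ‖iter ω (k i) w‖ ^ 2) :=
      Real.le_sqrt_of_sq_le (by linarith)
    simp only [id, ← hk i]
    change 2 / Real.sqrt (1 + ‖iter ω (k i) w‖ ^ 2) < ε
    have hpos : 0 < Real.sqrt (1 + ‖iter ω (k i) w‖ ^ 2) := Real.sqrt_pos.2 (by positivity)
    rw [div_lt_iff₀ hpos]
    rw [div_lt_iff₀ hε] at h3
    nlinarith

/-! ### Square roots on sets cut out by a polynomial-like inequality -/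

/-- The function `x ↦ x - a` has a continuous square root on `X`. -/
def HasSqrtSub (X : Set ℂ) (a : ℂ) : Prop :=
  ∃ s : ℂ → ℂ, ContinuousOn s X ∧ ∀ x ∈ X, s x ^ 2 = x - a

theorem re_pos_of_norm_sub_one_lt {u : ℂ} (h : ‖1 - u‖ < 1) : 0 < u.re := by
  have := (Complex.re_le_norm (1 - u)).trans_lt h
  simp at this; exact this

theorem exists_sqrt_of_re_pos {X : Set ℂ} {f : ℂ → ℂ} (hf : ContinuousOn f X)
    (h : ∀ x ∈ X, 0 < (f x).re) :
    ∃ s : ℂ → ℂ, ContinuousOn s X ∧ ∀ x ∈ X, s x ^ 2 = f x := by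
  refine ⟨fun x => f x ^ (1 / 2 : ℂ), hf.cpow_const fun x hx => Or.inl (h x hx), fun x _ => ?_⟩
  rw [← Complex.cpow_nat_mul]; simp

/-- The quotient `(x - b) / (x - a)` stays within distance 1 of 1, where the principal root is
continuous. Thus solvability is unchanged by small moves of `a` away from `X`. -/
theorem HasSqrtSub.of_norm_sub_lt {X : Set ℂ} {a b : ℂ} {r : ℝ} (hab : ‖b - a‖ < r)
    (hX : ∀ x ∈ X, r ≤ ‖x - a‖) (h : HasSqrtSub X a) : HasSqrtSub X b := by
  have hr : 0 < r := (norm_nonneg _).trans_lt hab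
  have hne : ∀ x ∈ X, x - a ≠ 0 := fun x hx h0 => by
    have := hX x hx; rw [h0, norm_zero] at this; linarith
  obtain ⟨s, hs, hs2⟩ := h
  obtain ⟨t, ht, ht2⟩ := exists_sqrt_of_re_pos (X := X) (f := fun x => (x - b) / (x - a))
    (ContinuousOn.div (by fun_prop) (by fun_prop) hne) (fun x hx => by
      apply re_pos_of_norm_sub_one_lt
      have : 1 - (x - b) / (x - a) = (b - a) / (x - a) := by
        field_simp [hne x hx]; ring
      rw [this, norm_div, div_lt_one (norm_pos_iff.2 (hne x hx))]
      exact hab.trans_le (hX x hx))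
  refine ⟨fun x => s x * t x, hs.mul ht, fun x hx => ?_⟩
  rw [mul_pow, hs2 x hx, ht2 x hx, mul_div_cancel₀ _ (hne x hx)]

theorem hasSqrtSub_of_norm_lt {X : Set ℂ} {a : ℂ} (h : ∀ x ∈ X, ‖x‖ < ‖a‖) :
    HasSqrtSub X a := by
  by_cases ha : a = 0
  · exact ⟨id, continuousOn_id, fun x hx => absurd (h x hx) (by simp [ha])⟩
  obtain ⟨b, hb⟩ := IsAlgClosed.exists_pow_nat_eq (-a) two_pos
  obtain ⟨t, ht, ht2⟩ := exists_sqrt_of_re_pos (X := X) (f := fun x => 1 - x / a)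
    (by fun_prop) (fun x hx => by
      apply re_pos_of_norm_sub_one_lt
      rw [sub_sub_cancel, norm_div, div_lt_one (norm_pos_iff.2 ha)]
      exact h x hx)
  refine ⟨fun x => b * t x, continuousOn_const.mul ht, fun x hx => ?_⟩
  rw [mul_pow, hb, ht2 x hx]; field_simp; ring

/-- The maximum principle makes `c` connected to infinity outside `X`. -/
theorem hasSqrtSub_of_lt_norm {X : Set ℂ} {q : ℂ → ℂ} (hq : Differentiable ℂ q) {R B : ℝ}
    (hXB : ∀ x ∈ X, ‖x‖ < B) (hXq : ∀ x ∈ X, ‖q x‖ ≤ R) {c : ℂ} (hc : R < ‖q c‖) :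
    HasSqrtSub X c := by
  set O : Set ℂ := {a | R < ‖q a‖} with hO
  have hOo : IsOpen O := isOpen_lt continuous_const hq.continuous.norm
  set S : Set ℂ := {a | a ∈ O ∧ ¬ HasSqrtSub X a} with hS
  -- Having a square root is locally constant in `a` on `O`. The radius is halved so that `b` also
  -- stays away from `X` and the argument can be reversed.
  have hloc : ∀ a ∈ O, ∃ r > 0, ∀ b, ‖b - a‖ < r → (HasSqrtSub X a ↔ HasSqrtSub X b) := by
    intro a ha
    obtain ⟨ρ, hρ, hball⟩ := Metric.isOpen_iff.1 hOo a ha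
    have hfar : ∀ x ∈ X, ρ ≤ ‖x - a‖ := fun x hx => by
      by_contra! hlt
      exact (hball (mem_ball_iff_norm.2 hlt) : R < ‖q x‖).not_ge (hXq x hx)
    refine ⟨ρ / 2, half_pos hρ, fun b hb => ⟨fun h => ?_, fun h => ?_⟩⟩
    · exact h.of_norm_sub_lt (hb.trans (half_lt_self hρ)) hfar
    · refine h.of_norm_sub_lt (r := ρ / 2) (by rwa [norm_sub_rev]) fun x hx => ?_
      have h1 := hfar x hx
      have h2 := norm_add_le (x - b) (b - a)
      rw [sub_add_sub_cancel] at h2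
      linarith
  -- By local constancy the frontier of `S` avoids `O`. As `S` is bounded, the maximum principle
  -- would force `‖q c‖ ≤ R` if `c` were in `S`.
  have hfr : ∀ z ∈ frontier S, ‖q z‖ ≤ R := by
    intro z hz
    by_contra! hzO
    obtain ⟨r, hr, hr'⟩ := hloc z hzO
    obtain ⟨ρ, hρ, hball⟩ := Metric.isOpen_iff.1 hOo z hzO
    rw [frontier_eq_closure_inter_closure] at hz
    obtain ⟨a, ha, haz⟩ := Metric.mem_closure_iff.1 hz.1 (min r ρ) (lt_min hr hρ)
    obtain ⟨b, hb, hbz⟩ := Metric.mem_closure_iff.1 hz.2 (min r ρ) (lt_min hr hρ)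
    rw [dist_comm, dist_eq_norm, lt_min_iff] at haz hbz
    exact hb ⟨hball (mem_ball_iff_norm.2 hbz.2), fun h => ha.2 ((hr' a haz.1).1 ((hr' b hbz.1).2 h))⟩
  have hSb : Bornology.IsBounded S := by
    refine isBounded_iff_forall_norm_le.2 ⟨B, fun a ha => ?_⟩
    by_contra! hlt
    exact ha.2 (hasSqrtSub_of_norm_lt fun x hx => (hXB x hx).trans hlt)
  by_contra hcS
  exact hc.not_ge (Complex.norm_le_of_forall_mem_frontier_norm_le hSb hq.diffContOnCl hfr
    (subset_closure ⟨hc, hcS⟩))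

/-! ### Injectivity of the iterates on connected sets without critical points -/

/-- On `Y` both `s (z ^ 2 + c)` and `z` are continuous roots of `z ^ 2`. Connectedness and `0 ∉ Y`
fix one sign throughout, so `z ^ 2 + c` determines `z`. -/
theorem injOn_sq_add_of_hasSqrtSub {Y : Set ℂ} (hY : IsPreconnected Y) {c : ℂ} (h0 : (0 : ℂ) ∉ Y)
    (h : HasSqrtSub ((fun z => z ^ 2 + c) '' Y) c) : InjOn (fun z : ℂ => z ^ 2 + c) Y := by
  obtain ⟨s, hs, hs2⟩ := h
  have hcont : ContinuousOn (fun z => s (z ^ 2 + c)) Y :=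
    hs.comp (f := fun z : ℂ => z ^ 2 + c) (by fun_prop) (mapsTo_image _ _)
  have hsq : EqOn ((fun z => s (z ^ 2 + c)) ^ 2) ((fun z : ℂ => z) ^ 2) Y := fun z hz => by
    have := hs2 _ (mem_image_of_mem _ hz)
    simpa using this
  rcases hY.eq_or_eq_neg_of_sq_eq hcont continuousOn_id hsq
    (fun {z} hz h => h0 (by simp at h; rwa [h] at hz)) with h | h
  · intro x hx y hy hxy
    have h1 := h hx; have h2 := h hy
    simp only [id] at h1 h2 hxy
    rw [← h1, ← h2, hxy]
  · intro x hx y hy hxy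
    have h1 := h hx; have h2 := h hy
    simp only [Pi.neg_apply, id] at h1 h2 hxy
    rw [← neg_inj, ← h1, ← h2, hxy]

/-- Injectivity is only claimed up to time `m`, while escape is tested at the later time `n`. At
each quadratic step the critical value escapes and the image of the set does not, so
`hasSqrtSub_of_lt_norm` provides the root. -/
theorem injOn_iter {M R : ℝ} (hR : M + 2 ≤ R) (m n : ℕ) (hmn : m ≤ n) {ω : ℕ → ℂ}
    (hω : ∀ i, ‖ω i‖ ≤ M) {Y : Set ℂ} (hY : IsPreconnected Y) (hYR : ∀ y ∈ Y, ‖iter ω n y‖ ≤ R)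
    (hcrit : ∀ j < m, R < ‖iter (shift j ω) (n - j) 0‖) : InjOn (iter ω m) Y := by
  induction m generalizing n ω Y with
  | zero => exact fun x _ y _ h => h
  | succ m ih =>
    obtain ⟨n, rfl⟩ : ∃ k, n = k + 1 := ⟨n - 1, by omega⟩
    have hX : ∀ x ∈ (fun z => z ^ 2 + ω 0) '' Y, ‖iter (shift 1 ω) n x‖ ≤ R := by
      rintro _ ⟨y, hy, rfl⟩
      rw [← iter_succ_eq]; exact hYR y hy
    have hc0 : R < ‖iter ω (n + 1) 0‖ := hcrit 0 (by omega)
    have hcomp : iter ω (m + 1) = iter (shift 1 ω) m ∘ fun z => z ^ 2 + ω 0 := by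
      funext z; exact iter_succ_eq ω m z
    rw [hcomp]
    refine InjOn.comp (t := (fun z => z ^ 2 + ω 0) '' Y) ?_ ?_ (mapsTo_image _ _)
    · refine ih n (by omega) (norm_shift_le hω 1) (hY.image _ (by fun_prop)) hX fun j hj => ?_
      have := hcrit (j + 1) (by omega)
      rwa [shift_shift, show n - j = n + 1 - (j + 1) by omega]
    · refine injOn_sq_add_of_hasSqrtSub hY (fun h => (hYR 0 h).not_gt hc0) ?_
      refine hasSqrtSub_of_lt_norm (differentiable_iter (shift 1 ω) n) (B := R + 1) (R := R)
        (fun x hx => ?_) hX ?_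
      · by_contra! hlt
        have := norm_le_iter (norm_shift_le hω 1) (z := x) (by linarith) n
        linarith [hX x hx]
      · rw [iter_succ_eq] at hc0; simpa using hc0

/-! ### Inverse branches -/

/-- A primitive of `h' / h` on the disc is a logarithm of `h`; half of it is exponentiated. -/
theorem exists_sqrt_on_ball {h : ℂ → ℂ} {w : ℂ} {r : ℝ} (hr : 0 < r)
    (hh : DifferentiableOn ℂ h (ball w r)) (h0 : ∀ x ∈ ball w r, h x ≠ 0) :
    ∃ s : ℂ → ℂ, DifferentiableOn ℂ s (ball w r) ∧ ∀ x ∈ ball w r, s x ^ 2 = h x := by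
  have hlog : DifferentiableOn ℂ (fun x => deriv h x / h x) (ball w r) :=
    (hh.deriv isOpen_ball).div hh h0
  obtain ⟨g, hgw, hg⟩ := hlog.isExactOn_ball.with_val_at w (Complex.log (h w))
  have hw := mem_ball_self (x := w) hr
  have hder : ∀ x ∈ ball w r, HasDerivAt (fun x => h x * Complex.exp (-g x)) 0 x := by
    intro x hx
    have h1 := (hh.differentiableAt (isOpen_ball.mem_nhds hx)).hasDerivAt
    have h2 := (hg x hx).neg.cexp
    refine HasDerivAt.congr_deriv (h1.mul h2) ?_
    rw [Pi.neg_apply]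
    have := h0 x hx
    field_simp
    ring
  have hconst : ∀ x ∈ ball w r, h x * Complex.exp (-g x) = 1 := by
    intro x hx
    have := isOpen_ball.is_const_of_deriv_eq_zero (convex_ball w r).isPreconnected
      (fun y hy => (hder y hy).differentiableAt.differentiableWithinAt)
      (fun y hy => (hder y hy).deriv) hx hw
    rw [this, hgw, Complex.exp_neg, Complex.exp_log (h0 w hw), mul_inv_cancel₀ (h0 w hw)]
  refine ⟨fun x => Complex.exp (g x / 2), fun x hx => ?_, fun x hx => ?_⟩
  · exact ((hg x hx).differentiableAt.div_const 2).cexp.differentiableWithinAt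
  · have h1 := hconst x hx
    rw [Complex.exp_neg, mul_inv_eq_one₀ (Complex.exp_ne_zero _)] at h1
    rw [← Complex.exp_nat_mul, h1]
    congr 1; push_cast; ring

/-- The points excluded by `hcrit` are the critical values of `iter ω m`. The branch is lifted
through one square root at a time. -/
theorem exists_inverse_branch (m : ℕ) {ω : ℕ → ℂ} {w z : ℂ} {r : ℝ} (hr : 0 < r)
    (hz : iter ω m z = w) (hcrit : ∀ j < m, iter (shift j ω) (m - j) 0 ∉ ball w r) :
    ∃ g : ℂ → ℂ, DifferentiableOn ℂ g (ball w r) ∧ g w = z ∧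
      ∀ x ∈ ball w r, iter ω m (g x) = x := by
  induction m generalizing ω z with
  | zero => exact ⟨id, differentiableOn_id, hz.symm, fun _ _ => rfl⟩
  | succ m ih =>
    obtain ⟨g, hg, hgw, hgi⟩ := ih (ω := shift 1 ω) (z := z ^ 2 + ω 0)
      (by rw [← iter_succ_eq, hz]) (fun j hj => by
        have := hcrit (j + 1) (by omega)
        rwa [shift_shift, show m - j = m + 1 - (j + 1) by omega])
    have hne : ∀ x ∈ ball w r, g x - ω 0 ≠ 0 := fun x hx h => by
      apply hcrit 0 (by omega)
      have h1 := hgi x hx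
      rw [sub_eq_zero.1 h] at h1
      change iter ω (m + 1) 0 ∈ _
      rw [iter_succ_eq]; simpa [h1] using hx
    obtain ⟨s, hs, hs2⟩ := exists_sqrt_on_ball hr (hg.sub_const (ω 0)) hne
    -- Both signs of the root give inverse branches; the sign is chosen to send `w` to `z`.
    have hsi : ∀ ε : ℂ, ε ^ 2 = 1 → ∀ x ∈ ball w r, iter ω (m + 1) (ε * s x) = x := by
      intro ε hε x hx
      rw [iter_succ_eq, mul_pow, hε, one_mul, hs2 x hx, sub_add_cancel, hgi x hx]
    have hw2 : s w ^ 2 = z ^ 2 := by rw [hs2 w (mem_ball_self hr), hgw]; ring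
    rcases sq_eq_sq_iff_eq_or_eq_neg.1 hw2 with h | h
    · exact ⟨fun x => 1 * s x, hs.const_mul 1, by simp [h], hsi 1 (by norm_num)⟩
    · exact ⟨fun x => -1 * s x, hs.const_mul (-1), by simp [h], hsi (-1) (by norm_num)⟩

/-! ### Distortion of bounded holomorphic maps omitting many points -/

/-- A quantitative open mapping theorem: a large derivative at `w` forces the image to contain a
disc about `g w`, hence the omitted point `d`. -/
theorem sq_norm_deriv_mul_le {g : ℂ → ℂ} {w d : ℂ} {r B ε : ℝ} (hr : 0 < r) (hB : 0 < B)
    (hg : DifferentiableOn ℂ g (ball w r)) (hgB : ∀ x ∈ ball w r, ‖g x‖ ≤ B)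
    (hd : ‖d - g w‖ < ε) (hdg : d ∉ g '' ball w r) :
    ‖deriv g w‖ ^ 2 * r ^ 2 ≤ 32 * B * ε := by
  have hw := mem_ball_self (x := w) hr
  have hε : 0 < ε := (norm_nonneg _).trans_lt hd
  by_cases hη : deriv g w = 0
  · rw [hη]; simp; positivity
  set η := ‖deriv g w‖ with hηdef
  have hηpos : 0 < η := norm_pos_iff.2 hη
  have hmaps : MapsTo g (ball w r) (closedBall (g w) (2 * B)) := fun x hx => by
    rw [mem_closedBall, dist_eq_norm]
    linarith [norm_sub_le (g x) (g w), hgB x hx, hgB w hw]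
  set k := dslope g w with hk
  have hkb : ∀ x ∈ ball w r, ‖k x‖ ≤ 2 * B / r := fun x hx =>
    Complex.norm_dslope_le_div_of_mapsTo_ball hg hmaps hx
  have hkw : k w = deriv g w := dslope_same g w
  have hηle : η ≤ 2 * B / r := by rw [hηdef, ← hkw]; exact hkb w hw
  have hkd : DifferentiableOn ℂ k (ball w r) :=
    (Complex.differentiableOn_dslope (isOpen_ball.mem_nhds hw)).2 hg
  have hkmaps : MapsTo k (ball w r) (closedBall (k w) (4 * B / r)) := fun x hx => by
    rw [mem_closedBall, dist_eq_norm]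
    have h1 := norm_sub_le (k x) (k w)
    have h2 := hkb x hx
    have h3 := hkb w hw
    have h4 : 4 * B / r = 2 * B / r + 2 * B / r := by ring
    linarith
  -- At this radius the Schwarz estimate lets the slope `k` vary by at most `η / 2`, so `‖g z - g w‖
  -- ≥ t * (η / 2)` on the circle. The image then contains a disc of half that radius.
  set t := η * r ^ 2 / (8 * B) with ht
  have htpos : 0 < t := by positivity
  have htr : t < r := by
    rw [ht, div_lt_iff₀ (by positivity)]
    rw [le_div_iff₀ hr] at hηle
    nlinarith
  have hsphere : ∀ z ∈ sphere w t, η ^ 2 * r ^ 2 / (16 * B) ≤ ‖g z - g w‖ := by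
    intro z hz
    have hzt : ‖z - w‖ = t := mem_sphere_iff_norm.1 hz
    have hzr : z ∈ ball w r := by rw [mem_ball_iff_norm, hzt]; exact htr
    have h1 := Complex.dist_le_div_mul_dist_of_mapsTo_ball hkd hkmaps hzr
    rw [dist_eq_norm, dist_eq_norm, hzt, hkw] at h1
    have h2 : 4 * B / r / r * t = η / 2 := by rw [ht]; field_simp; ring
    have h3 : η / 2 ≤ ‖k z‖ := by
      have := norm_sub_norm_le (deriv g w) (k z)
      rw [norm_sub_rev] at this
      linarith
    have h4 : g z - g w = (z - w) * k z := by
      rw [← smul_eq_mul, hk, sub_smul_dslope]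
    rw [h4, norm_mul, hzt]
    calc η ^ 2 * r ^ 2 / (16 * B) = t * (η / 2) := by rw [ht]; field_simp; ring
      _ ≤ _ := by gcongr
  have hfreq : ∃ᶠ z in 𝓝 w, g z ≠ g w := by
    intro h
    have h' : g =ᶠ[𝓝 w] fun _ => g w := by
      filter_upwards [h] with z hz using not_not.1 hz
    exact hη (by rw [h'.deriv_eq]; simp)
  have hsub : closedBall w t ⊆ ball w r := closedBall_subset_ball htr
  have hdc : DiffContOnCl ℂ g (ball w t) :=
    ((hg.mono hsub).diffContOnCl_ball subset_rfl)
  have himg := hdc.ball_subset_image_closedBall htpos hsphere hfreq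
  by_contra! hlt
  refine hdg (image_mono hsub (himg ?_))
  rw [mem_ball_iff_norm]
  refine hd.trans ?_
  rw [div_div, lt_div_iff₀ (by positivity)]
  linarith

/-- The net has mesh `κ ^ 2 / (128 * B)` so that the previous estimate on discs of radius `r / 2`
yields `‖deriv g‖ ≤ κ / r`. -/
theorem norm_sub_le_of_omits {g : ℂ → ℂ} {w : ℂ} {r B κ : ℝ} (hr : 0 < r) (hB : 0 < B)
    (hκ : 0 ≤ κ) (hg : DifferentiableOn ℂ g (ball w r)) (hgB : ∀ x ∈ ball w r, ‖g x‖ ≤ B)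
    (homit : ∀ p, ‖p‖ ≤ B → ∃ d, ‖d - p‖ < κ ^ 2 / (128 * B) ∧ d ∉ g '' ball w r) :
    ∀ y ∈ ball w (r / 2), ‖g y - g w‖ ≤ κ := by
  intro y hy
  have hhalf : ball w (r / 2) ⊆ ball w r := ball_subset_ball (by linarith)
  have hder : ∀ x ∈ ball w (r / 2), ‖deriv g x‖ ≤ κ / r := by
    intro x hx
    have hsub : ball x (r / 2) ⊆ ball w r := by
      refine ball_subset_ball' ?_
      have := mem_ball.1 hx
      linarith
    obtain ⟨d, hd, hdo⟩ := homit (g x) (hgB x (hhalf hx))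
    have := sq_norm_deriv_mul_le (half_pos hr) hB (hg.mono hsub) (fun z hz => hgB z (hsub hz)) hd
      (fun h => hdo (image_mono hsub h))
    have h2 : 32 * B * (κ ^ 2 / (128 * B)) = κ ^ 2 / 4 := by field_simp; ring
    rw [le_div_iff₀ hr]
    refine le_of_sq_le_sq ?_ hκ
    nlinarith
  have := (convex_ball w (r / 2)).norm_image_sub_le_of_norm_deriv_le (f := g) (C := κ / r)
    (fun x hx => hg.differentiableAt (isOpen_ball.mem_nhds (hhalf hx))) hder
    (mem_ball_self (half_pos hr)) hy
  refine this.trans ?_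
  have hyr : ‖y - w‖ ≤ r := (mem_ball_iff_norm.1 hy).le.trans (by linarith)
  calc κ / r * ‖y - w‖ ≤ κ / r * r := by gcongr
    _ = κ := div_mul_cancel₀ _ hr.ne'

/-! ### Coverings of connected sets, stability of orbits, escaping nets -/

/-- A connected set covered by finitely many sets of small diameter has small diameter. -/
theorem IsPreconnected.norm_sub_le_card_mul {ι : Type*} {T : Set ℂ} (hT : IsPreconnected T)
    {s : Finset ι} {A : ι → Set ℂ} (hcov : T ⊆ ⋃ i ∈ s, A i) {κ : ℝ} (hκ : 0 ≤ κ)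
    (hA : ∀ i ∈ s, ∀ x ∈ T ∩ A i, ∀ y ∈ T ∩ A i, ‖x - y‖ ≤ κ) {x y : ℂ} (hx : x ∈ T) (hy : y ∈ T) :
    ‖x - y‖ ≤ s.card * κ := by
  -- The distance from `x` maps `T` onto a set containing `[0, ‖x - y‖]`, which is covered by sets
  -- of diameter at most `κ`; their lengths add up.
  set h : ℂ → ℝ := fun z => ‖z - x‖ with hh
  have hpre : IsPreconnected (h '' T) := hT.image h (by fun_prop)
  have hsub : Icc 0 ‖x - y‖ ⊆ h '' T :=
    hpre.Icc_subset ⟨x, hx, by simp [hh]⟩ ⟨y, hy, norm_sub_rev y x⟩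
  have hsub2 : Icc 0 ‖x - y‖ ⊆ ⋃ i ∈ s, h '' (T ∩ A i) := by
    refine hsub.trans ?_
    rintro _ ⟨z, hz, rfl⟩
    obtain ⟨i, hi, hzi⟩ := mem_iUnion₂.1 (hcov hz)
    exact mem_iUnion₂.2 ⟨i, hi, z, ⟨hz, hzi⟩, rfl⟩
  have hvol : volume (Icc 0 ‖x - y‖) ≤ ∑ i ∈ s, ENNReal.ofReal κ := by
    refine (measure_mono hsub2).trans ((measure_biUnion_finset_le _ _).trans
      (Finset.sum_le_sum fun i hi => (Real.volume_le_diam _).trans ?_))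
    refine Metric.ediam_le ?_
    rintro _ ⟨a, ha, rfl⟩ _ ⟨b, hb, rfl⟩
    rw [edist_dist, Real.dist_eq]
    refine ENNReal.ofReal_le_ofReal ((abs_norm_sub_norm_le _ _).trans ?_)
    rw [sub_sub_sub_cancel_right]
    exact hA i hi a ha b hb
  rw [Real.volume_Icc, sub_zero, Finset.sum_const, nsmul_eq_mul, ← ENNReal.ofReal_natCast,
    ← ENNReal.ofReal_mul (by positivity)] at hvol
  exact (ENNReal.ofReal_le_ofReal_iff (by positivity)).1 hvol

/-- Orbits staying in a fixed disc depend uniformly continuously on the starting point, uniformly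
in the parameters. -/
theorem exists_delta_iter (R : ℝ) (N : ℕ) {ε : ℝ} (hε : 0 < ε) :
    ∃ δ > 0, ∀ (τ : ℕ → ℂ) (w : ℂ), (∀ k, ‖iter τ k w‖ ≤ R) → ∀ x ∈ ball w δ,
      ‖iter τ N x - iter τ N w‖ < ε := by
  induction N generalizing ε with
  | zero => exact ⟨ε, hε, fun τ w _ x hx => mem_ball_iff_norm.1 hx⟩
  | succ N ih =>
    have hpos : 0 < 2 * |R| + 2 := by positivity
    obtain ⟨δ, hδ, h⟩ := ih (ε := min 1 (ε / (2 * |R| + 2))) (by positivity)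
    refine ⟨δ, hδ, fun τ w hw x hx => ?_⟩
    have h1 := lt_min_iff.1 (h τ w hw x hx)
    have h2 := (hw N).trans (le_abs_self R)
    set a := iter τ N x
    set b := iter τ N w
    have h3 : ‖a + b‖ ≤ 2 * |R| + 1 := by
      have h4 : a + b = (a - b) + 2 * b := by ring
      rw [h4]
      refine (norm_add_le _ _).trans ?_
      rw [norm_mul, Complex.norm_ofNat]
      linarith
    have h5 : iter τ (N + 1) x - iter τ (N + 1) w = (a - b) * (a + b) := by
      simp only [iter, a, b]; ring
    rw [h5, norm_mul]
    have h6 := h1.2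
    rw [lt_div_iff₀ hpos] at h6
    nlinarith [norm_nonneg (a - b)]

/-- If a dense set of points escapes, then every bounded region is finely filled with points that
have escaped by a common time. -/
theorem exists_escaping_net {M R : ℝ} {ω : ℕ → ℂ} (hω : ∀ i, ‖ω i‖ ≤ M) (hR : M + 2 ≤ R)
    {D : Set ℂ} (hD : Dense D) (hesc : ∀ d ∈ D, ∃ n, R < ‖iter ω n d‖) (B : ℝ) {ε : ℝ}
    (hε : 0 < ε) :
    ∃ n₀, ∀ n ≥ n₀, ∀ p, ‖p‖ ≤ B → ∃ d, ‖d - p‖ < ε ∧ R < ‖iter ω n d‖ := by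
  have hpt : ∀ p : ℂ, ∃ d ∈ D, dist p d < ε / 2 := fun p =>
    Metric.dense_iff.1 hD p (ε / 2) (half_pos hε) |>.imp fun d hd => ⟨hd.2, by
      rw [dist_comm]; exact hd.1⟩
  choose d hdD hd using hpt
  choose! k hk using hesc
  obtain ⟨t, -, ht⟩ := (isCompact_closedBall (0 : ℂ) B).elim_finite_subcover_image
    (b := univ) (c := fun p => ball p (ε / 2)) (fun _ _ => isOpen_ball)
    (fun p _ => mem_iUnion₂.2 ⟨p, mem_univ _, mem_ball_self (half_pos hε)⟩)
  obtain ⟨htf, ht⟩ := ht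
  obtain ⟨n₀, hn₀⟩ := (htf.image fun p => k (d p)).bddAbove
  refine ⟨n₀, fun n hn p hp => ?_⟩
  obtain ⟨q, hq, hpq⟩ := mem_iUnion₂.1 (ht (mem_closedBall_zero_iff.2 hp))
  refine ⟨d q, ?_, lt_norm_iter_of_le hω hR ((hn₀ (mem_image_of_mem _ hq)).trans hn) (hk _ (hdD q))⟩
  rw [← dist_eq_norm]
  have := dist_triangle (d q) q p
  have h1 := hd q
  rw [dist_comm] at h1
  have h2 := mem_ball.1 hpq
  rw [dist_comm] at h2
  linarith

/-! ### Total disconnectedness under frequent escape of the critical points -/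

/-- At a time `n` at which all critical points born before `n - N` have escaped, a connected set of
points with bounded orbits is covered by boundedly many small pieces. -/
theorem norm_sub_le_of_critical_escape {M B κ δ : ℝ} {ω : ℕ → ℂ} (hω : ∀ i, ‖ω i‖ ≤ M)
    (hB : B = M + 3) (hδ : 0 < δ) (hκ : 0 ≤ κ) {m N : ℕ}
    (hδN : ∀ (τ : ℕ → ℂ) (w : ℂ), (∀ k, ‖iter τ k w‖ ≤ M + 2) → ∀ x ∈ ball w δ,
      ‖iter τ N x - iter τ N w‖ < 1)
    (hcrit : ∀ j < m, B < ‖iter (shift j ω) (m + N - j) 0‖)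
    (hnet : ∀ p, ‖p‖ ≤ B → ∃ d, ‖d - p‖ < κ ^ 2 / (128 * B) ∧ B < ‖iter ω (m + N) d‖)
    {s : Finset ℂ} (hs : closedBall (0 : ℂ) (M + 2) ⊆ ⋃ p ∈ s, ball p (δ / 4))
    {T : Set ℂ} (hT : IsPreconnected T) (hTK : ∀ z ∈ T, ∀ n, ‖iter ω n z‖ ≤ M + 2)
    {x y : ℂ} (hx : x ∈ T) (hy : y ∈ T) : ‖x - y‖ ≤ s.card * κ := by
  have hM : 0 ≤ M := (norm_nonneg _).trans (hω 0)
  set F := iter ω m with hF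
  -- The unit gap between `M + 2` and `B` absorbs the perturbation over the last `N` steps.
  have hnear : ∀ z ∈ T, ∀ w ∈ ball (F z) δ, ‖iter (shift m ω) N w‖ ≤ B := by
    intro z hz w hw
    have hb : ∀ k, ‖iter (shift m ω) k (F z)‖ ≤ M + 2 := fun k => by
      rw [hF, ← iter_add]; exact hTK z hz _
    have h1 := hδN (shift m ω) (F z) hb w hw
    have h2 := norm_sub_norm_le (iter (shift m ω) N w) (iter (shift m ω) N (F z))
    linarith [hb N]
  have hbranch : ∀ z ∈ T, ∃ g : ℂ → ℂ, DifferentiableOn ℂ g (ball (F z) δ) ∧ g (F z) = z ∧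
      ∀ w ∈ ball (F z) δ, F (g w) = w := by
    intro z hz
    -- A critical value in the disc would not have escaped at time `m + N`, against `hcrit`.
    refine exists_inverse_branch m hδ rfl fun j hj hmem => ?_
    have h1 := hnear z hz _ hmem
    have h2 := hcrit j hj
    have h3 : shift m ω = shift (m - j) (shift j ω) := by
      rw [shift_shift, Nat.sub_add_cancel hj.le]
    rw [h3, ← iter_add, show m - j + N = m + N - j by omega] at h1
    linarith
  choose! g hgd hgz hgi using hbranch
  -- `T` is enlarged by the branch images so that injectivity of `F` on one connected set identifies
  -- the point `b` of a piece with `g a (F b)`.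
  set Y : Set ℂ := T ∪ ⋃ z ∈ T, g z '' ball (F z) δ with hY
  have hTY : T ⊆ Y := subset_union_left
  have hgY : ∀ z ∈ T, ∀ w ∈ ball (F z) δ, g z w ∈ Y := fun z hz w hw =>
    Or.inr (mem_iUnion₂.2 ⟨z, hz, mem_image_of_mem _ hw⟩)
  have hYpre : IsPreconnected Y := by
    refine isPreconnected_of_forall x fun v hv => ?_
    rcases hv with hv | hv
    · exact ⟨T, hTY, hx, hv, hT⟩
    · obtain ⟨z, hz, hvz⟩ := mem_iUnion₂.1 hv
      refine ⟨T ∪ g z '' ball (F z) δ, union_subset hTY ?_, Or.inl hx, Or.inr hvz, ?_⟩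
      · rintro _ ⟨w, hw, rfl⟩; exact hgY z hz w hw
      · refine hT.union z hz ⟨F z, mem_ball_self hδ, hgz z hz⟩ ?_
        exact (convex_ball _ _).isPreconnected.image _ (hgd z hz).continuousOn
  have hgbound : ∀ z ∈ T, ∀ w ∈ ball (F z) δ, ‖iter ω (m + N) (g z w)‖ ≤ B := by
    intro z hz w hw
    rw [iter_add, ← hF, hgi z hz w hw]
    exact hnear z hz w hw
  have hYB : ∀ v ∈ Y, ‖iter ω (m + N) v‖ ≤ B := by
    rintro v (hv | hv)
    · linarith [hTK v hv (m + N)]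
    · obtain ⟨z, hz, w, hw, rfl⟩ := mem_iUnion₂.1 hv
      exact hgbound z hz w hw
  have hinj : InjOn F Y :=
    injOn_iter (by linarith) m (m + N) (by omega) hω hYpre hYB hcrit
  refine IsPreconnected.norm_sub_le_card_mul hT (A := fun p => F ⁻¹' ball p (δ / 4)) ?_ hκ ?_ hx hy
  · intro z hz
    have := hs (mem_closedBall_zero_iff.2 (hTK z hz m))
    simpa using this
  · rintro p - a ⟨ha, hap⟩ b ⟨hb, hbp⟩
    have hab : F b ∈ ball (F a) (δ / 2) := by
      rw [mem_ball]
      have := dist_triangle_right (F b) (F a) p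
      have h1 := mem_ball.1 hap
      have h2 := mem_ball.1 hbp
      linarith
    have hab' : F b ∈ ball (F a) δ := ball_subset_ball (by linarith) hab
    have hgb : g a (F b) = b := hinj (hgY a ha _ hab') (hTY hb) (hgi a ha _ hab')
    have := norm_sub_le_of_omits (κ := κ) (B := B) hδ (by linarith) hκ (hgd a ha) (fun w hw => ?_)
      (fun q hq => ?_) (F b) hab
    · rwa [hgb, hgz a ha, norm_sub_rev] at this
    · by_contra! hlt
      have := norm_le_iter hω (z := g a w) (by linarith) (m + N)
      linarith [hgbound a ha w hw]
    · obtain ⟨d, hd, hdB⟩ := hnet q hq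
      refine ⟨d, hd, ?_⟩
      rintro ⟨w, hw, rfl⟩
      exact (hgbound a ha w hw).not_gt hdB

theorem subsingleton_of_frequently_critical_escape {M : ℝ} {ω : ℕ → ℂ} (hω : ∀ i, ‖ω i‖ ≤ M)
    {D : Set ℂ} (hD : Dense D) (hesc : ∀ d ∈ D, ∃ n, M + 3 < ‖iter ω n d‖) {N : ℕ}
    (hfreq : ∃ᶠ n in atTop, ∀ j, j + N ≤ n → M + 3 < ‖iter (shift j ω) (n - j) 0‖)
    {T : Set ℂ} (hT : IsPreconnected T) (hTK : ∀ z ∈ T, ∀ n, ‖iter ω n z‖ ≤ M + 2) :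
    T.Subsingleton := by
  have hM : 0 ≤ M := (norm_nonneg _).trans (hω 0)
  obtain ⟨δ, hδ, hδN⟩ := exists_delta_iter (M + 2) N one_pos
  obtain ⟨s, -, hs⟩ := (isCompact_closedBall (0 : ℂ) (M + 2)).elim_nhds_subcover
    (fun p => ball p (δ / 4)) (fun p _ => ball_mem_nhds p (by positivity))
  intro x hx y hy
  by_contra hne
  have hpos : 0 < ‖x - y‖ := norm_pos_iff.2 (sub_ne_zero.2 hne)
  -- The number of pieces was fixed before `κ`; the extra 1 makes `s.card * κ` strictly less than
  -- `‖x - y‖`.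
  set κ := ‖x - y‖ / (s.card + 1) with hκdef
  have hκ : 0 < κ := by positivity
  obtain ⟨n₀, hn₀⟩ := exists_escaping_net hω (by linarith) hD hesc (M + 3)
    (ε := κ ^ 2 / (128 * (M + 3))) (by positivity)
  obtain ⟨n, hn, hcrit⟩ := frequently_atTop.1 hfreq (n₀ + N)
  obtain ⟨m, rfl⟩ : ∃ m, n = m + N := ⟨n - N, by omega⟩
  have := norm_sub_le_of_critical_escape hω rfl hδ hκ.le hδN
    (fun j hj => hcrit j (by omega)) (hn₀ _ (by omega)) hs hT hTK hx hy
  have h2 : ‖x - y‖ = (s.card + 1) * κ := by rw [hκdef]; field_simp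
  linarith

section

/-! ### Steering every point to infinity -/

/-- Some sequence of parameters in `V` sends `z` outside the closed disc of radius `R`. -/
def CanEscape (V : Set ℂ) (R : ℝ) (z : ℂ) : Prop :=
  ∃ c : ℕ → ℂ, (∀ i, c i ∈ V) ∧ ∃ m, R < ‖iter c m z‖

theorem CanEscape.of_step {V : Set ℂ} {R : ℝ} {z x : ℂ} (hx : x ∈ V)
    (h : CanEscape V R (z ^ 2 + x)) : CanEscape V R z := by
  obtain ⟨c, hc, m, hm⟩ := h
  refine ⟨fun n => Nat.casesOn n x c, fun i => ?_, m + 1, ?_⟩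
  · cases i with
    | zero => exact hx
    | succ i => exact hc i
  · rw [iter_succ_eq]; exact hm

variable {V : Set ℂ} {R : ℝ}

theorem mul_mem_of_norm_eq_one (hsub : ball (0 : ℂ) (1 / 4) ⊆ V) {s : ℝ} (hs0 : 0 ≤ s)
    (hs : s < 1 / 4) {u : ℂ} (hu : ‖u‖ = 1) : (s : ℂ) * u ∈ V := by
  apply hsub
  rw [mem_ball_zero_iff, norm_mul, hu, mul_one, Complex.norm_real, Real.norm_of_nonneg hs0]
  exact hs

/-- Parameters of modulus `s < 1/4` aligned with `w ^ 2` give the radial map `r ↦ r ^ 2 + s`. Since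
`r ^ 2 + s - r = (r - 1/2) ^ 2 - (1/4 - s)`, the choice of `s` makes each step gain at least `γ`. -/
theorem canEscape_of_half_lt (hsub : ball (0 : ℂ) (1 / 4) ⊆ V) {z : ℂ} (hz : 1 / 2 < ‖z‖) :
    CanEscape V R z := by
  set r₀ := ‖z‖ with hr₀
  set s : ℝ := max 0 (1 / 4 - (r₀ - 1 / 2) ^ 2 / 2) with hs
  have hs0 : 0 ≤ s := le_max_left _ _
  have hs4 : s < 1 / 4 := by
    refine max_lt (by norm_num) ?_
    nlinarith [pow_pos (sub_pos.2 hz) 2]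
  have hs' : 1 / 4 - (r₀ - 1 / 2) ^ 2 / 2 ≤ s := le_max_right _ _
  set γ := (r₀ - 1 / 2) ^ 2 / 2 with hγ
  have hγpos : 0 < γ := by have := pow_pos (sub_pos.2 hz) 2; positivity
  have key : ∀ k : ℕ, ∀ w : ℂ, r₀ ≤ ‖w‖ → R < ‖w‖ + k * γ → CanEscape V R w := by
    intro k
    induction k with
    | zero => exact fun w _ h => ⟨fun _ => 0, fun _ => hsub (by simp), 0, by simpa [iter] using h⟩
    | succ k ih =>
      intro w hw h
      have hw0 : w ≠ 0 := norm_pos_iff.1 (by linarith)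
      set u : ℂ := w / (‖w‖ : ℂ) with hu
      have hwn : (‖w‖ : ℂ) ≠ 0 := by simpa using hw0
      have hu1 : ‖u‖ = 1 := by rw [hu, norm_div]; simp [hw0]
      have hwu : w = ‖w‖ * u := by rw [hu]; field_simp
      have hu2 : ‖u ^ 2‖ = 1 := by rw [norm_pow, hu1, one_pow]
      have hstep : ‖w ^ 2 + s * u ^ 2‖ = ‖w‖ ^ 2 + s := by
        have h1 : w ^ 2 + s * u ^ 2 = ((‖w‖ ^ 2 + s : ℝ) : ℂ) * u ^ 2 := by
          conv_lhs => rw [hwu]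
          push_cast; ring
        rw [h1, norm_mul, hu2, mul_one, Complex.norm_real, Real.norm_of_nonneg (by positivity)]
      have hgrow : ‖w‖ + γ ≤ ‖w‖ ^ 2 + s := by nlinarith
      refine CanEscape.of_step (mul_mem_of_norm_eq_one hsub hs0 hs4 hu2) (ih _ ?_ ?_)
      · rw [hstep]; linarith
      · rw [hstep]; push_cast at h; linarith
  obtain ⟨k, hk⟩ := exists_nat_gt ((R - r₀) / γ)
  rw [div_lt_iff₀ hγpos] at hk
  exact key k z le_rfl (by linarith)

/-- The orbit moves radially for `k` steps while its argument doubles. The condition on `u` aligns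
the last square with `a`, so that the moduli add and the radius 1/2 is passed. -/
theorem canEscape_of_iterate (hsub : ball (0 : ℂ) (1 / 4) ⊆ V) {a : ℂ} (ha : a ∈ V) (ha0 : a ≠ 0)
    {s : ℝ} (hs0 : 0 ≤ s) (hs4 : s < 1 / 4) (k : ℕ) {r : ℝ} (hr : 0 ≤ r) {u : ℂ} (hu : ‖u‖ = 1)
    (huk : u ^ 2 ^ (k + 1) = a / ‖a‖) (hk : 1 / 2 < ((fun t : ℝ => t ^ 2 + s)^[k] r) ^ 2 + ‖a‖) :
    CanEscape V R (r * u) := by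
  induction k generalizing r u with
  | zero =>
    refine CanEscape.of_step ha (canEscape_of_half_lt hsub ?_)
    have han : (‖a‖ : ℂ) ≠ 0 := by simpa using ha0
    have h1 : (r * u) ^ 2 + a = ((r ^ 2 + ‖a‖ : ℝ) : ℂ) * u ^ 2 := by
      simp only [zero_add, pow_one] at huk
      have h2 : a = ‖a‖ * u ^ 2 := by rw [huk]; field_simp
      conv_lhs => rw [h2]
      push_cast; ring
    rw [h1, norm_mul, norm_pow, hu, one_pow, mul_one, Complex.norm_real,
      Real.norm_of_nonneg (by positivity)]
    simpa using hk
  | succ k ih =>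
    have hu2 : ‖u ^ 2‖ = 1 := by rw [norm_pow, hu, one_pow]
    refine CanEscape.of_step (mul_mem_of_norm_eq_one hsub hs0 hs4 hu2) ?_
    have h1 : (r * u) ^ 2 + s * u ^ 2 = ((r ^ 2 + s : ℝ) : ℂ) * u ^ 2 := by push_cast; ring
    rw [h1]
    refine ih (by positivity) hu2 ?_ ?_
    · rw [← pow_mul, ← pow_succ', huk]
    · rwa [Function.iterate_succ_apply] at hk

/-- Below `b` each step gains at least `(1/2 - b) ^ 2 / 2`, so the orbit cannot remain there. -/
theorem exists_iterate_gt {b s : ℝ} (hb : b < 1 / 2)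
    (hs : s = 1 / 4 - (1 / 2 - b) ^ 2 / 2) : ∃ k : ℕ, b < (fun t : ℝ => t ^ 2 + s)^[k] 0 := by
  by_contra! hle
  have hγ : 0 < (1 / 2 - b) ^ 2 / 2 := by have := pow_pos (sub_pos.2 hb) 2; positivity
  have hgrow : ∀ k : ℕ, k * ((1 / 2 - b) ^ 2 / 2) ≤ (fun t : ℝ => t ^ 2 + s)^[k] 0 := by
    intro k
    induction k with
    | zero => simp
    | succ k ih =>
      rw [Function.iterate_succ_apply']
      have := hle k
      push_cast
      nlinarith
  obtain ⟨k, hk⟩ := exists_nat_gt (b / ((1 / 2 - b) ^ 2 / 2))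
  rw [div_lt_iff₀ hγ] at hk
  linarith [hgrow k, hle k]

theorem canEscape_zero (hsub : ball (0 : ℂ) (1 / 4) ⊆ V) {a : ℂ} (ha : a ∈ V) (ha4 : 1 / 4 < ‖a‖) :
    CanEscape V R 0 := by
  have ha0 : a ≠ 0 := norm_pos_iff.1 (by linarith)
  -- From radius above `1/2 - e`, adding `‖a‖ ≥ 1/4 + 2 * e` to the square exceeds 1/2. The bound
  -- `1/4` keeps `1/2 - e` positive and `s` nonnegative.
  set e := min ((‖a‖ - 1 / 4) / 2) (1 / 4) with he
  have he0 : 0 < e := lt_min (by linarith) (by norm_num)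
  have he1 : e ≤ (‖a‖ - 1 / 4) / 2 := min_le_left _ _
  have he2 : e ≤ 1 / 4 := min_le_right _ _
  obtain ⟨k, hk⟩ := exists_iterate_gt (b := 1 / 2 - e) (by linarith) rfl
  obtain ⟨u, hu⟩ := IsAlgClosed.exists_pow_nat_eq (a / ‖a‖ : ℂ) (n := 2 ^ (k + 1)) (by positivity)
  have hu1 : ‖u‖ = 1 := by
    have : ‖u‖ ^ 2 ^ (k + 1) = 1 := by rw [← norm_pow, hu, norm_div]; simp [ha0]
    exact (pow_eq_one_iff_of_nonneg (norm_nonneg _) (by positivity)).1 this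
  have := canEscape_of_iterate (R := R) hsub ha ha0 (s := 1 / 4 - (1 / 2 - (1 / 2 - e)) ^ 2 / 2)
    (by nlinarith) (by nlinarith) k le_rfl hu1 hu (by nlinarith)
  simpa using this

theorem canEscape (hsub : ball (0 : ℂ) (1 / 4) ⊆ V) {a : ℂ} (ha : a ∈ V) (ha4 : 1 / 4 < ‖a‖)
    (z : ℂ) : CanEscape V R z := by
  have hlt : ∀ w : ℂ, ‖w‖ < 1 / 2 → CanEscape V R w := fun w hw => by
    refine CanEscape.of_step (x := -w ^ 2) (hsub ?_) ?_
    · rw [mem_ball_zero_iff, norm_neg, norm_pow]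
      nlinarith [norm_nonneg w]
    · simpa using canEscape_zero hsub ha ha4
  rcases lt_trichotomy ‖z‖ (1 / 2) with h | h | h
  · exact hlt z h
  · refine CanEscape.of_step (x := 0) (hsub (by simp)) (hlt _ ?_)
    rw [add_zero, norm_pow, h]; norm_num
  · exact canEscape_of_half_lt hsub h

/-- A point of `V` outside the disc may lie on its boundary circle; openness allows pushing it
radially outwards. -/
theorem exists_mem_norm_gt (hVo : IsOpen V) (hsub : ball (0 : ℂ) (1 / 4) ⊆ V)
    (hne : V ≠ ball (0 : ℂ) (1 / 4)) : ∃ a ∈ V, 1 / 4 < ‖a‖ := by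
  obtain ⟨b, hbV, hb⟩ := exists_of_ssubset (hsub.ssubset_of_ne hne.symm)
  rw [mem_ball_zero_iff, not_lt] at hb
  have hcont : Tendsto (fun t : ℝ => (t : ℂ) * b) (𝓝[>] 1) (𝓝 b) := by
    have : Continuous fun t : ℝ => (t : ℂ) * b := by fun_prop
    simpa using (this.tendsto 1).mono_left nhdsWithin_le_nhds
  obtain ⟨t, htV, ht⟩ := ((hcont.eventually (hVo.mem_nhds hbV)).and self_mem_nhdsWithin).exists
  refine ⟨_, htV, ?_⟩
  have ht1 : (1 : ℝ) < t := ht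
  rw [norm_mul, Complex.norm_real, Real.norm_of_nonneg (by linarith)]
  nlinarith

end

section

/-! ### The product measure and the shift -/

/-- Prepending an entry to a sequence. -/
def consSeq {α : Type*} (p : α × (ℕ → α)) : ℕ → α := fun n => Nat.casesOn n p.1 p.2

theorem measurable_consSeq {α : Type*} [MeasurableSpace α] : Measurable (consSeq (α := α)) := by
  refine measurable_pi_iff.2 fun n => ?_
  cases n with
  | zero => exact measurable_fst
  | succ n => exact (measurable_pi_apply n).comp measurable_snd

theorem measurable_shift {α : Type*} [MeasurableSpace α] (j : ℕ) :
    Measurable (shift (α := α) j) :=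
  measurable_pi_iff.2 fun n => measurable_pi_apply (n + j)

theorem measurePreserving_consSeq {α : Type*} [MeasurableSpace α] (μ : Measure α)
    [IsProbabilityMeasure μ] :
    MeasurePreserving consSeq (μ.prod (Measure.infinitePi fun _ : ℕ => μ))
      (Measure.infinitePi fun _ : ℕ => μ) := by
  classical
  refine ⟨measurable_consSeq, Measure.eq_infinitePi _ fun s t ht => ?_⟩
  -- The finite box is padded with `univ` to an initial segment of indices, so that coordinate 0
  -- splits off.
  obtain ⟨n, hn⟩ : ∃ n, s ⊆ Finset.range (n + 1) :=
    ⟨s.sup id, fun i hi => Finset.mem_range.2 (Nat.lt_succ_of_le (Finset.le_sup (f := id) hi))⟩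
  set t' : ℕ → Set α := fun i => if i ∈ s then t i else univ with ht'
  have hmt' : ∀ i, MeasurableSet (t' i) := fun i => by
    simp only [ht']; split_ifs; exacts [ht i, MeasurableSet.univ]
  have hpi : (s : Set ℕ).pi t = (Finset.range (n + 1) : Set ℕ).pi t' := by
    ext x
    simp only [Set.mem_pi, Finset.mem_coe, ht']
    refine ⟨fun h i _ => ?_, fun h i hi => by simpa [hi] using h i (hn hi)⟩
    split_ifs with hi
    · exact h i hi
    · trivial
  have hprod : ∏ i ∈ s, μ (t i) = ∏ i ∈ Finset.range (n + 1), μ (t' i) := by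
    rw [← Finset.prod_subset hn fun i _ hi => by simp [ht', hi]]
    exact Finset.prod_congr rfl fun i hi => by simp [ht', hi]
  have hpre : consSeq ⁻¹' ((Finset.range (n + 1) : Set ℕ).pi t') =
      t' 0 ×ˢ ((Finset.range n : Set ℕ).pi fun i => t' (i + 1)) := by
    ext ⟨x, ω⟩
    simp only [mem_preimage, Set.mem_pi, Finset.mem_coe, Finset.mem_range, mem_prod]
    constructor
    · exact fun h => ⟨h 0 (by omega), fun i hi => h (i + 1) (by omega)⟩
    · rintro ⟨h0, h⟩ (_ | i) hi
      · exact h0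
      · exact h i (by omega)
  rw [hpi, hprod, Measure.map_apply measurable_consSeq
    (MeasurableSet.pi (Finset.countable_toSet _) fun i _ => hmt' i), hpre, Measure.prod_prod,
    Measure.infinitePi_pi _ (fun i _ => hmt' _), Finset.prod_range_succ', mul_comm]

theorem measurePreserving_shift {α : Type*} [MeasurableSpace α] (μ : Measure α)
    [IsProbabilityMeasure μ] (j : ℕ) :
    MeasurePreserving (shift j) (Measure.infinitePi fun _ : ℕ => μ)
      (Measure.infinitePi fun _ : ℕ => μ) := by
  have h1 : MeasurePreserving (shift 1) (Measure.infinitePi fun _ : ℕ => μ)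
      (Measure.infinitePi fun _ : ℕ => μ) := by
    refine ⟨measurable_shift 1, ?_⟩
    have hsnd : shift 1 ∘ consSeq = (Prod.snd : α × (ℕ → α) → ℕ → α) := rfl
    conv_lhs => rw [← (measurePreserving_consSeq μ).map_eq]
    rw [Measure.map_map (measurable_shift 1) measurable_consSeq, hsnd]
    exact measurePreserving_snd.map_eq
  induction j with
  | zero => exact MeasurePreserving.id _
  | succ j ih =>
    have : shift (α := α) (j + 1) = shift j ∘ shift 1 := by
      funext ω; exact (shift_shift j 1 ω).symm
    rw [this]; exact ih.comp h1

theorem infinitePi_pos_of_isOpen {α : Type*} [TopologicalSpace α] [MeasurableSpace α]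
    [OpensMeasurableSpace α] (μ : Measure α) [IsProbabilityMeasure μ] [μ.IsOpenPosMeasure]
    {W : Set (ℕ → α)} (hW : IsOpen W) {a : ℕ → α} (ha : a ∈ W) :
    0 < Measure.infinitePi (fun _ : ℕ => μ) W := by
  obtain ⟨I, u, hu, hsub⟩ := isOpen_pi_iff.1 hW a ha
  refine lt_of_lt_of_le ?_ (measure_mono hsub)
  rw [Measure.infinitePi_pi _ fun i hi => (hu i hi).1.measurableSet]
  exact CanonicallyOrderedAdd.prod_pos.2 fun i hi => (hu i hi).1.measure_pos μ ⟨_, (hu i hi).2⟩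

/-- This is Fatou's lemma for sets. -/
theorem measure_eventually_le {α : Type*} [MeasurableSpace α] (P : Measure α) {A : ℕ → Set α}
    {c : ENNReal} (hA : ∀ n, P (A n) ≤ c) : P {ω | ∀ᶠ n in atTop, ω ∈ A n} ≤ c := by
  have hset : {ω | ∀ᶠ n in atTop, ω ∈ A n} = ⋃ k, ⋂ n, ⋂ _ : k ≤ n, A n := by
    ext ω; simp [eventually_atTop]
  have hmono : Monotone fun k => ⋂ n, ⋂ _ : k ≤ n, A n := fun k l hkl =>
    iInter_mono fun n => iInter_mono' fun h => ⟨hkl.trans h, subset_rfl⟩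
  rw [hset, hmono.measure_iUnion]
  exact iSup_le fun k => (measure_mono (iInter₂_subset k le_rfl)).trans (hA k)

/-! ### The probability of not having escaped -/

variable {V : Set ℂ}

/-- The sequence of complex parameters underlying a sequence in `V`. -/
def params (ω : ℕ → V) : ℕ → ℂ := fun n => (ω n : ℂ)

theorem continuous_iter_params (m : ℕ) :
    Continuous fun p : ℂ × (ℕ → V) => iter (params p.2) m p.1 := by
  induction m with
  | zero => exact continuous_fst
  | succ m ih =>
    have : Continuous fun p : ℂ × (ℕ → V) => ((p.2 m : V) : ℂ) := by fun_prop
    exact (ih.pow 2).add this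

theorem measurableSet_iter_le (R : ℝ) (m : ℕ) (z : ℂ) :
    MeasurableSet {ω : ℕ → V | ‖iter (params ω) m z‖ ≤ R} :=
  (isClosed_le ((continuous_iter_params m).comp (Continuous.prodMk_right z)).norm
    continuous_const).measurableSet

/-- The probability that the `m`-th iterate of `z` lies in the closed disc of radius `R`. -/
def stayProb (μ : Measure V) (R : ℝ) (m : ℕ) (z : ℂ) : ENNReal :=
  Measure.infinitePi (fun _ : ℕ => μ) {ω : ℕ → V | ‖iter (params ω) m z‖ ≤ R}

variable {μ : Measure V} {M R : ℝ}

theorem stayProb_antitone (hVM : ∀ x ∈ V, ‖x‖ ≤ M) (hR : M + 2 ≤ R) {m n : ℕ} (hmn : m ≤ n)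
    (z : ℂ) : stayProb μ R n z ≤ stayProb μ R m z := by
  refine measure_mono fun ω hω => ?_
  simp only [mem_ofPred_eq] at hω ⊢
  by_contra! h
  exact (lt_norm_iter_of_le (fun i => hVM _ (ω i).2) hR hmn h).not_ge hω

theorem stayProb_eq_zero (hVM : ∀ x ∈ V, ‖x‖ ≤ M) (hR : M + 2 ≤ R) (m : ℕ) {z : ℂ} (hz : R < ‖z‖) :
    stayProb μ R m z = 0 := by
  have h0 : stayProb μ R 0 z = 0 := by
    have : {ω : ℕ → V | ‖iter (params ω) 0 z‖ ≤ R} = ∅ := by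
      ext ω; simpa [iter] using hz
    rw [stayProb, this, measure_empty]
  exact le_antisymm (h0 ▸ stayProb_antitone hVM hR (Nat.zero_le m) z) zero_le

variable [IsProbabilityMeasure μ]

theorem stayProb_succ (m : ℕ) (z : ℂ) :
    stayProb μ R (m + 1) z = ∫⁻ x : V, stayProb μ R m (z ^ 2 + x) ∂μ := by
  have hm := measurableSet_iter_le (V := V) R (m + 1) z
  rw [stayProb, ← (measurePreserving_consSeq μ).measure_preimage hm.nullMeasurableSet,
    Measure.prod_apply (measurable_consSeq hm)]
  refine lintegral_congr fun x => ?_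
  rw [stayProb]
  congr 1
  ext ω
  simp only [mem_preimage, mem_ofPred_eq, iter_succ_eq]
  rfl

theorem stayProb_le_one (m : ℕ) (z : ℂ) : stayProb μ R m z ≤ 1 := prob_le_one

/-- The Markov property: after the first `k` steps the point must still be in the disc, and the next
`m` steps cost a factor `c` wherever it is. -/
theorem stayProb_add_le (hVM : ∀ x ∈ V, ‖x‖ ≤ M) (hR : M + 2 ≤ R) {m : ℕ} {c : ENNReal}
    (hc : c ≠ ⊤) (h : ∀ z, stayProb μ R m z ≤ c) (k : ℕ) (z : ℂ) :
    stayProb μ R (m + k) z ≤ c * stayProb μ R k z := by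
  induction k generalizing z with
  | zero =>
    by_cases hz : ‖z‖ ≤ R
    · have : stayProb μ R 0 z = 1 := by simp [stayProb, iter, hz]
      rw [this, mul_one]; exact h z
    · rw [add_zero, stayProb_eq_zero hVM hR m (not_le.1 hz)]; exact zero_le
  | succ k ih =>
    rw [← add_assoc, stayProb_succ, stayProb_succ, ← lintegral_const_mul' _ _ hc]
    exact lintegral_mono fun x => ih _

theorem exists_stayProb_le [μ.IsOpenPosMeasure] (hVM : ∀ x ∈ V, ‖x‖ ≤ M) (hR : M + 2 ≤ R)
    (hesc : ∀ z, CanEscape V R z) : ∃ N, ∃ c < (1 : ENNReal), ∀ z, stayProb μ R N z ≤ c := by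
  have hcomp : ∃ N, ∃ c < (1 : ENNReal), ∀ z ∈ closedBall (0 : ℂ) R,
      ∀ n ≥ N, stayProb μ R n z ≤ c := by
    refine (isCompact_closedBall (0 : ℂ) R).induction_on (p := fun S => ∃ N, ∃ c < (1 : ENNReal),
      ∀ z ∈ S, ∀ n ≥ N, stayProb μ R n z ≤ c) ?_ ?_ ?_ ?_
    · exact ⟨0, 0, one_pos, fun z hz => absurd hz (notMem_empty z)⟩
    · rintro S T hST ⟨N, c, hc, h⟩
      exact ⟨N, c, hc, fun z hz => h z (hST hz)⟩
    · rintro S T ⟨N, c, hc, h⟩ ⟨N', c', hc', h'⟩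
      refine ⟨max N N', max c c', max_lt hc hc', ?_⟩
      rintro z (hz | hz) n hn
      · exact (h z hz n (le_of_max_le_left hn)).trans (le_max_left _ _)
      · exact (h' z hz n (le_of_max_le_right hn)).trans (le_max_right _ _)
    · intro z _
      obtain ⟨a, ha, m, hm⟩ := hesc z
      set ω₀ : ℕ → V := fun i => ⟨a i, ha i⟩
      -- Escape at time `m` is open in the point and the parameters jointly, so one open set `W` of
      -- sequences of positive measure serves a whole neighbourhood of `z`.
      have hopen : IsOpen {p : ℂ × (ℕ → V) | R < ‖iter (params p.2) m p.1‖} :=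
        isOpen_lt continuous_const (continuous_iter_params m).norm
      obtain ⟨U, W, hU, hW, hzU, hωW, hUW⟩ := isOpen_prod_iff.1 hopen z ω₀ hm
      have hpos := infinitePi_pos_of_isOpen μ hW hωW
      refine ⟨U, mem_nhdsWithin_of_mem_nhds (hU.mem_nhds hzU), m,
        1 - Measure.infinitePi (fun _ : ℕ => μ) W,
        ENNReal.sub_lt_self ENNReal.one_ne_top one_ne_zero hpos.ne', fun w hw n hn => ?_⟩
      refine (stayProb_antitone hVM hR hn w).trans ?_
      rw [← prob_compl_eq_one_sub hW.measurableSet]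
      refine measure_mono fun ω hω hωW' => ?_
      have hlt : R < ‖iter (params ω) m w‖ := hUW (mk_mem_prod hw hωW')
      exact not_le_of_gt hlt hω
  obtain ⟨N, c, hc, h⟩ := hcomp
  refine ⟨N, c, hc, fun z => ?_⟩
  by_cases hz : ‖z‖ ≤ R
  · exact h z (mem_closedBall_zero_iff.2 hz) N le_rfl
  · rw [stayProb_eq_zero hVM hR N (not_le.1 hz)]; exact zero_le

theorem stayProb_mul_le (hVM : ∀ x ∈ V, ‖x‖ ≤ M) (hR : M + 2 ≤ R) {N : ℕ} {c : ENNReal}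
    (hc : c < 1) (h : ∀ z, stayProb μ R N z ≤ c) (k : ℕ) (z : ℂ) :
    stayProb μ R (k * N) z ≤ c ^ k := by
  induction k generalizing z with
  | zero => simpa using stayProb_le_one _ _
  | succ k ih =>
    rw [Nat.succ_mul, pow_succ]
    exact (stayProb_add_le hVM hR (ENNReal.pow_ne_top hc.ne_top) ih N z).trans
      (mul_le_mul_right (h z) _)

theorem tsum_stayProb_ne_top [μ.IsOpenPosMeasure] (hVM : ∀ x ∈ V, ‖x‖ ≤ M) (hR : M + 2 ≤ R)
    (hesc : ∀ z, CanEscape V R z) (z : ℂ) : ∑' m, stayProb μ R m z ≠ ⊤ := by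
  obtain ⟨N, c, hc, h⟩ := exists_stayProb_le (μ := μ) hVM hR hesc
  -- Blocks of length `N + 1` remain nonempty when `N = 0`.
  have hN : ∀ w, stayProb μ R (N + 1) w ≤ c := fun w =>
    (stayProb_antitone hVM hR N.le_succ w).trans (h w)
  have hpart : ∀ k : ℕ, ∑ m ∈ Finset.range (k * (N + 1)), stayProb μ R m z ≤
      ∑ i ∈ Finset.range k, (N + 1 : ℕ) * c ^ i := by
    intro k
    induction k with
    | zero => simp
    | succ k ih =>
      rw [Nat.succ_mul, Finset.sum_range_add,
        Finset.sum_range_succ fun i => ((N + 1 : ℕ) : ENNReal) * c ^ i]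
      refine add_le_add ih ?_
      refine (Finset.sum_le_card_nsmul _ _ (c ^ k) fun i _ => ?_).trans_eq ?_
      · exact (stayProb_antitone hVM hR (Nat.le_add_right _ i) z).trans
          (stayProb_mul_le hVM hR hc hN k z)
      · rw [Finset.card_range, nsmul_eq_mul]
  have hfin : ∑' i : ℕ, ((N + 1 : ℕ) : ENNReal) * c ^ i ≠ ⊤ := by
    rw [ENNReal.tsum_mul_left, ENNReal.tsum_geometric]
    exact ENNReal.mul_ne_top (ENNReal.natCast_ne_top _)
      (ENNReal.inv_ne_top.2 (tsub_pos_of_lt hc).ne')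
  refine ne_top_of_le_ne_top hfin ?_
  rw [ENNReal.tsum_eq_iSup_nat]
  refine iSup_le fun k => ?_
  refine le_trans (Finset.sum_le_sum_of_subset (Finset.range_mono ?_))
    ((hpart k).trans (ENNReal.sum_le_tsum _))
  exact Nat.le_mul_of_pos_right k N.succ_pos

/-! ### Almost sure behaviour -/

theorem ae_exists_lt_norm_iter [μ.IsOpenPosMeasure] (hVM : ∀ x ∈ V, ‖x‖ ≤ M) (hR : M + 2 ≤ R)
    (hesc : ∀ z, CanEscape V R z) (z : ℂ) :
    ∀ᵐ ω ∂(Measure.infinitePi fun _ : ℕ => μ), ∃ n, R < ‖iter (params ω) n z‖ := by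
  have hlim : Tendsto (fun m => stayProb μ R m z) atTop (𝓝 0) :=
    ENNReal.tendsto_atTop_zero_of_tsum_ne_top (tsum_stayProb_ne_top hVM hR hesc z)
  rw [ae_iff]
  refine le_antisymm (ge_of_tendsto' hlim fun m => measure_mono fun ω hω => ?_) zero_le
  simp only [mem_ofPred_eq, not_exists, not_lt] at hω
  exact hω m

/-- By shift invariance a critical point born at time `j` contributes according to its age `n - j ≥
N`. The union bound is thus a tail of a convergent series, uniformly in `n`. -/
theorem measure_exists_not_escaped_le (N n : ℕ) :
    Measure.infinitePi (fun _ : ℕ => μ)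
      {ω | ∃ j, j + N ≤ n ∧ ‖iter (shift j (params ω)) (n - j) 0‖ ≤ R} ≤
      ∑' i, stayProb μ R (i + N) 0 := by
  set k := n + 1 - N with hk
  have hsub : {ω : ℕ → V | ∃ j, j + N ≤ n ∧ ‖iter (shift j (params ω)) (n - j) 0‖ ≤ R} ⊆
      ⋃ j ∈ Finset.range k, shift j ⁻¹' {ω : ℕ → V | ‖iter (params ω) (n - j) 0‖ ≤ R} := by
    rintro ω ⟨j, hj, h⟩
    exact mem_iUnion₂.2 ⟨j, Finset.mem_range.2 (by omega), h⟩
  refine (measure_mono hsub).trans ((measure_biUnion_finset_le _ _).trans ?_)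
  calc _ = ∑ j ∈ Finset.range k, stayProb μ R (k - 1 - j + N) 0 := by
        refine Finset.sum_congr rfl fun j hj => ?_
        have := Finset.mem_range.1 hj
        rw [(measurePreserving_shift μ j).measure_preimage
          (measurableSet_iter_le R (n - j) 0).nullMeasurableSet, stayProb,
          show k - 1 - j + N = n - j by omega]
    _ = ∑ j ∈ Finset.range k, stayProb μ R (j + N) 0 :=
        Finset.sum_range_reflect (fun j => stayProb μ R (j + N) 0) k
    _ ≤ _ := ENNReal.sum_le_tsum _

theorem ae_frequently_critical_escape [μ.IsOpenPosMeasure] (hVM : ∀ x ∈ V, ‖x‖ ≤ M)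
    (hR : M + 2 ≤ R) (hesc : ∀ z, CanEscape V R z) :
    ∀ᵐ ω ∂(Measure.infinitePi fun _ : ℕ => μ), ∃ N, ∃ᶠ n in atTop, ∀ j, j + N ≤ n →
      R < ‖iter (shift j (params ω)) (n - j) 0‖ := by
  have hlim := ENNReal.tendsto_sum_nat_add (fun m => stayProb μ R m 0)
    (tsum_stayProb_ne_top hVM hR hesc 0)
  rw [ae_iff]
  refine le_antisymm (ge_of_tendsto' hlim fun N => ?_) zero_le
  -- For each `N`, an exceptional `ω` has at all large times an unescaped critical point of age at
  -- least `N`.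
  refine (measure_mono fun ω hω => ?_).trans
    (measure_eventually_le _ (measure_exists_not_escaped_le N))
  simp only [mem_ofPred_eq, not_exists, not_frequently] at hω ⊢
  filter_upwards [hω N] with n hn
  push Not at hn
  exact hn

theorem isOpenPosMeasure_uniformDist (hV : IsOpen V) (hb : Bornology.IsBounded V) :
    (uniformDist V).IsOpenPosMeasure := by
  refine ⟨fun U hU hne => ?_⟩
  have hU' : IsOpen (Subtype.val '' U) := hV.isOpenMap_subtype_val U hU
  rw [uniformDist, (MeasurableEmbedding.subtype_coe hV.measurableSet).comap_apply,
    ProbabilityTheory.cond_apply hV.measurableSet,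
    inter_eq_self_of_subset_right (Subtype.coe_image_subset V U)]
  exact mul_ne_zero (ENNReal.inv_ne_zero.2 hb.measure_lt_top.ne)
    (hU'.measure_pos volume (hne.image _)).ne'

end

end RandomQuadratic

end

/-! ### Assembly of the almost sure statements -/

theorem theoremB (V : Set ℂ) (hVo : IsOpen V) (hVb : Bornology.IsBounded V)
    (hsub : Metric.ball (0 : ℂ) (1 / 4) ⊆ V) (hne : V ≠ Metric.ball (0 : ℂ) (1 / 4)) :
    ∀ᵐ ω : ℕ → V ∂(RandomQuadratic.productDist V),
      IsTotallyDisconnected (RandomQuadratic.juliaSet fun n => (ω n : ℂ)) := by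
  open RandomQuadratic in
  have hVne : V.Nonempty := ⟨0, hsub (by simp)⟩
  have hprob := isProbabilityMeasure_uniformDist hVo hVb hVne
  have hpos := isOpenPosMeasure_uniformDist hVo hVb
  obtain ⟨M, hM⟩ := isBounded_iff_forall_norm_le.1 hVb
  obtain ⟨a, haV, ha⟩ := exists_mem_norm_gt hVo hsub hne
  have hesc : ∀ z, CanEscape V (M + 3) z := canEscape hsub haV ha
  have hR : M + 2 ≤ M + 3 := by linarith
  -- Countability of `D` makes almost sure escape hold for all its points simultaneously.
  obtain ⟨D, hDc, hD⟩ := TopologicalSpace.exists_countable_dense ℂ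
  have hdense := (ae_ball_iff hDc).2 fun d _ =>
    ae_exists_lt_norm_iter (μ := uniformDist V) hM hR hesc d
  filter_upwards [hdense, ae_frequently_critical_escape (μ := uniformDist V) hM hR hesc]
    with ω hω ⟨N, hN⟩ T hTJ hT
  have hb : ∀ i, ‖params ω i‖ ≤ M := fun i => hM _ (ω i).2
  exact subsingleton_of_frequently_critical_escape hb hD hω hN hT fun z hz n =>
    norm_iter_le_of_mem_juliaSet hb (hTJ hz) n
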